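/- Let $\mathbb{F}$ be a (commutative) field whose algebraic closure $\overline{\mathbb{F}}$ has finite degree $m = [\overline{\mathbb{F}} : \mathbb{F}] \neq 1$ over $\mathbb{F}$, and suppose that $|\mathrm{Aut}(\mathbb{F})| < |\mathbb{F}|$, where $|\cdot|$ denotes cardinality and $\mathrm{Aut}(\mathbb{F})$ is the group of field automorphisms of $\mathbb{F}$. Let $n \geq 3$ be an odd integer, and let $\mathbf{PG}(n-1,\mathbb{F})$ be the projective space whose points and lines are the one- and two-dimensional linear subspaces of $\mathbb{F}^n$. Then $\mathbf{PG}(n-1,\mathbb{F})$ does not admit a Singer group; that is, there is no group of automorphisms of $\mathbf{PG}(n-1,\mathbb{F})$ (permutations $g$ of the points such that a set of points is a line if and only if its image under $g$ is a line) which acts sharply transitively on the points, i.e. such that for any two (not necessarily distinct) points $p, q$ exactly one element of the group maps $p$ to $q$. -/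

import Mathlib

open scoped LinearAlgebra.Projectivization

/-- The lines of the projective space `ℙ F V`: the point sets of the two-dimensional
linear subspaces of `V`. -/
def IsProjLine {F V : Type*} [Field F] [AddCommGroup V] [Module F V] (l : Set (ℙ F V)) : Prop :=
  ∃ W : Submodule F V, Module.finrank F W = 2 ∧ l = {p : ℙ F V | p.submodule ≤ W}

/-- The automorphism group of the projective space `ℙ F V`, as a point-line geometry: the group of
all permutations of the points under which lines correspond to lines (no semilinearity is
required). -/
def collineationGroup (F V : Type*) [Field F] [AddCommGroup V] [Module F V] :
    Subgroup (Equiv.Perm (ℙ F V)) where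
  carrier := {g | ∀ l : Set (ℙ F V), IsProjLine (g '' l) ↔ IsProjLine l}
  one_mem' := by
    intro l
    simp
  mul_mem' := by
    intro a b ha hb l
    have h : (⇑(a * b)) '' l = a '' (b '' l) := by
      rw [Equiv.Perm.coe_mul, Set.image_comp]
    rw [h, ha, hb]
  inv_mem' := by
    intro a ha l
    have h : a '' ((⇑a⁻¹) '' l) = l := by
      rw [← Set.image_comp, ← Equiv.Perm.coe_mul]
      simp
    rw [← ha, h]

/-- `S` is a Singer group of the projective space `ℙ F V`: a group of automorphisms of the
projective space that acts sharply transitively on its points. -/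
def IsSingerGroup {F V : Type*} [Field F] [AddCommGroup V] [Module F V]
    (S : Subgroup (Equiv.Perm (ℙ F V))) : Prop :=
  S ≤ collineationGroup F V ∧
    ∀ p q : ℙ F V, ∃! g : Equiv.Perm (ℙ F V), g ∈ S ∧ g p = q

/-! By the fundamental theorem of projective geometry, each collineation `g` comes from a bijective
semilinear map with a companion automorphism `σ g` of `F`. If `g` and `h` in a Singer group have the
same companion, then `(T h)⁻¹ ∘ T g` is linear on a space of odd dimension. An eigenvector of it is
a point where `g` and `h` agree, and sharp transitivity forces `g = h`. So the group embeds as a set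
in `Aut F`; but it has at least `|F|` elements, one for each target point on an affine line.

The eigenvector exists because odd-degree polynomials over `F` have roots. This is the
Artin–Schreier argument: the only prime that can divide the degree of an algebraically closed field
over a subfield is 2, so irreducible polynomials of odd degree are linear. -/

/-! ### Artin–Schreier theory: subfields of finite codegree in an algebraically closed field -/

section AlgClosed

open Polynomial IntermediateField

/-- A nonzero nilpotent endomorphism has a vector killed by its square but not by itself. -/
lemma LinearMap.exists_apply_ne_zero_of_isNilpotent {R M : Type*} [Ring R] [AddCommGroup M]
    [Module R M] {f : Module.End R M} (hf : IsNilpotent f) (h0 : f ≠ 0) :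
    ∃ x, f x ≠ 0 ∧ f (f x) = 0 := by
  by_contra! h
  have key : ∀ k x, (f ^ (k + 1)) x = 0 → f x = 0 := by
    intro k
    induction k with
    | zero => intro x hx; simpa using hx
    | succ k ih =>
      intro x hx
      by_contra hne
      refine h x hne (ih (f x) ?_)
      rw [pow_succ] at hx
      exact hx
  obtain ⟨n, hn⟩ := hf
  refine h0 (LinearMap.ext fun x => key n x ?_)
  rw [pow_succ', hn]
  simp

variable (L K : Type*) [Field L] [Field K] [Algebra L K] [IsAlgClosed K]

/-- An algebraically closed field of characteristic `p` is not cyclic of degree `p` over a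
subfield. -/
lemma IsAlgClosed.finrank_ne_char [FiniteDimensional L K] [IsGalois L K] (p : ℕ) [Fact p.Prime]
    [CharP L p] : Module.finrank L K ≠ p := by
  intro hd
  have : CharP K p := charP_of_injective_algebraMap (algebraMap L K).injective p
  have hcard : Nat.card Gal(K/L) = p := by rw [IsGalois.card_aut_eq_finrank, hd]
  have : IsCyclic Gal(K/L) := isCyclic_of_prime_card hcard
  obtain ⟨s, hs⟩ := IsCyclic.exists_generator (α := Gal(K/L))
  have hfix : ∀ x : K, s x = x → ∃ y : L, algebraMap L K y = x := by
    intro x hx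
    refine (IsGalois.mem_range_algebraMap_iff_fixed (F := L) x).2 fun t => ?_
    have hle : Subgroup.zpowers s ≤ MulAction.stabilizer Gal(K/L) x :=
      Subgroup.zpowers_le.2 hx
    exact hle (hs t)
  -- In characteristic `p`, `(s - 1) ^ p = s ^ p - 1 = 0`. A vector killed by `N ^ 2` but not by `N`
  -- will give `α` with `s α = α + 1`.
  let N : Module.End L K := s.toLinearMap - 1
  have hN : ∀ x, N x = s x - x := fun x => rfl
  have hpow : ∀ k x, (s.toLinearMap ^ k : Module.End L K) x = (s ^ k) x := by
    intro k
    induction k with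
    | zero => intro x; rfl
    | succ k ih => intro x; rw [pow_succ, pow_succ]; exact ih (s x)
  have hnil : IsNilpotent N := by
    refine ⟨p, ?_⟩
    have : CharP (Module.End L K) p :=
      charP_of_injective_algebraMap (algebraMap L (Module.End L K)).injective p
    rw [sub_pow_char_of_commute p (Commute.one_right _)]
    ext x
    have : s ^ p = 1 := by rw [← hcard]; exact pow_card_eq_one'
    simp [hpow, this]
  have hN0 : N ≠ 0 := by
    intro h0
    have hs1 : s = 1 := by
      ext x
      have := hN x
      rw [h0] at this
      exact (sub_eq_zero.1 this.symm)
    have : Nat.card Gal(K/L) = 1 := by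
      rw [Nat.card_eq_one_iff_unique]
      refine ⟨⟨fun a b => ?_⟩, ⟨1⟩⟩
      have ha := hs a
      have hb := hs b
      rw [hs1, Subgroup.zpowers_one_eq_bot, Subgroup.mem_bot] at ha hb
      rw [ha, hb]
    exact (Fact.out : p.Prime).one_lt.ne' (hcard.symm.trans this)
  obtain ⟨x, hx1, hx2⟩ := LinearMap.exists_apply_ne_zero_of_isNilpotent hnil hN0
  set y := N x with hy
  have hsy : s y = y := by rw [hN] at hx2; exact sub_eq_zero.1 hx2
  let α := x / y
  have hα : s α = α + 1 := by
    have : s x = x + y := by rw [hy, hN]; ring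
    simp only [α, map_div₀, hsy, this]
    field_simp
  -- The trace is onto and commutes with `e ↦ e ^ p - e`, so solvability of this equation descends
  -- from `K` to `L`.
  have hsurj : ∀ c : L, ∃ b : L, b ^ p - b = c := by
    intro c
    obtain ⟨d, hd⟩ := Algebra.trace_surjective L K c
    have hdeg : (X ^ p - X - C d : K[X]).degree ≠ 0 := by
      have hp1 := (Fact.out : p.Prime).one_lt
      have h1 : (X + C d : K[X]).degree < p := by
        rw [degree_X_add_C]; exact_mod_cast hp1
      have : (X ^ p - X - C d : K[X]) = X ^ p - (X + C d) := by ring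
      rw [this, degree_sub_eq_left_of_degree_lt (by simpa using h1), degree_X_pow]
      exact_mod_cast (by omega : p ≠ 0)
    obtain ⟨e, he⟩ := IsAlgClosed.exists_root _ hdeg
    have he' : d = e ^ p - e := by
      simp only [IsRoot.def, eval_sub, eval_pow, eval_X, eval_C] at he
      linear_combination -he
    refine ⟨Algebra.trace L K e, ?_⟩
    apply (algebraMap L K).injective
    rw [← hd, he', map_sub, map_sub, map_sub, map_pow]
    congr 1
    rw [trace_eq_sum_automorphisms, trace_eq_sum_automorphisms, sum_pow_char]
    simp
  obtain ⟨c, hc⟩ := hfix (α ^ p - α) (by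
    rw [map_sub, map_pow, hα, add_pow_char, one_pow]; ring)
  obtain ⟨b, hb⟩ := hsurj c
  -- Being fixed by Frobenius, `α - b` lies in the prime field, so `s` fixes it, against `s α = α +
  -- 1`.
  have hz : (α - algebraMap L K b) ^ p = α - algebraMap L K b := by
    rw [sub_pow_char, ← map_pow]
    have := congrArg (algebraMap L K) hb
    rw [map_sub, hc] at this
    linear_combination -this
  have hz2 : s (α - algebraMap L K b) = α - algebraMap L K b := by
    have hle : (⊥ : Subfield K) ≤ RingHom.eqLocusField (s : K →+* K) (RingHom.id K) := bot_le
    exact hle ((Subfield.mem_bot_iff_pow_eq_self K p).2 hz)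
  rw [map_sub, hα, AlgEquiv.commutes] at hz2
  exact one_ne_zero (α := K) (by linear_combination hz2)

/-- An algebraically closed field is not cyclic of odd prime degree over a subfield containing
the roots of unity of that order. -/
lemma IsAlgClosed.finrank_ne_of_cast_ne_zero [FiniteDimensional L K] [IsGalois L K] (p : ℕ)
    [hp : Fact p.Prime] (hodd : p ≠ 2) (hchar : (p : L) ≠ 0) : Module.finrank L K ≠ p := by
  intro hd
  have hcard : Nat.card Gal(K/L) = p := by rw [IsGalois.card_aut_eq_finrank, hd]
  have : IsCyclic Gal(K/L) := isCyclic_of_prime_card hcard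
  have : NeZero (p : K) := ⟨by
    rw [← map_natCast (algebraMap L K)]
    exact (_root_.map_ne_zero _).2 hchar⟩
  obtain ⟨ζ, hζ⟩ := HasEnoughRootsOfUnity.exists_primitiveRoot K p
  have hint : IsIntegral L ζ := Algebra.IsIntegral.isIntegral ζ
  have hdvd : (minpoly L ζ).natDegree ∣ p := hd ▸ minpoly.degree_dvd hint
  have hroot : aeval ζ (cyclotomic p L) = 0 := by
    rw [aeval_def, eval₂_eq_eval_map, map_cyclotomic]
    exact hζ.isRoot_cyclotomic hp.out.pos
  have hle : (minpoly L ζ).natDegree ≤ p - 1 := by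
    rw [← Nat.totient_prime hp.out, ← natDegree_cyclotomic p L]
    exact natDegree_le_natDegree (minpoly.min L ζ (cyclotomic.monic p L) hroot)
  -- The degree divides `p` and is at most `p - 1`, so `ζ` lies in `L` and Kummer theory applies.
  have h1 : (minpoly L ζ).natDegree = 1 := by
    rcases (Nat.dvd_prime hp.out).1 hdvd with h | h
    · exact h
    · have := hp.out.pos; omega
  obtain ⟨z, rfl⟩ : ζ ∈ (algebraMap L K).range := minpoly.natDegree_eq_one_iff.1 h1
  have hz : IsPrimitiveRoot z p := hζ.of_map_of_injective (algebraMap L K).injective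
  have hprim : (primitiveRoots (Module.finrank L K) L).Nonempty :=
    ⟨z, by rw [hd]; exact (mem_primitiveRoots hp.out.pos).2 hz⟩
  obtain ⟨α, ⟨a, ha⟩, htop⟩ := exists_root_adjoin_eq_top_of_isCyclic L K hprim
  have hirr := irreducible_X_pow_sub_C_of_root_adjoin_eq_top ha.symm htop
  rw [hd] at hirr
  have hnp := (X_pow_sub_C_irreducible_iff_of_prime_pow hp.out hodd (n := 1) one_ne_zero (a := a)).1
    (by simpa using hirr)
  -- For odd `p`, irreducibility passes from `X ^ p - a` to `X ^ p ^ 2 - a`, whose root in `K` would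
  -- have degree `p ^ 2` dividing `p`.
  have hirr2 := X_pow_sub_C_irreducible_of_prime_pow hp.out hodd 2 hnp
  obtain ⟨β, hβ⟩ := IsAlgClosed.exists_aeval_eq_zero K _ (degree_pos_of_irreducible hirr2).ne'
  have hdvd2 : (minpoly L β).natDegree ∣ p :=
    hd ▸ minpoly.degree_dvd (Algebra.IsIntegral.isIntegral β)
  rw [← minpoly.eq_of_irreducible_of_monic hirr2 hβ (monic_X_pow_sub_C _ (by simp [hp.out.ne_zero])),
    natDegree_X_pow_sub_C] at hdvd2
  have h2 := hp.out.one_lt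
  have := Nat.le_of_dvd hp.out.pos hdvd2
  nlinarith

lemma IsAlgClosed.finrank_ne_of_prime [FiniteDimensional L K] [IsGalois L K] (p : ℕ)
    [hp : Fact p.Prime] (hodd : p ≠ 2) : Module.finrank L K ≠ p := by
  by_cases h : (p : L) = 0
  · have : CharP L p := (CharP.charP_iff_prime_eq_zero hp.out).2 h
    exact IsAlgClosed.finrank_ne_char L K p
  · exact IsAlgClosed.finrank_ne_of_cast_ne_zero L K p hodd h

/-- A finite extension of fields whose top is algebraically closed is Galois. -/
lemma IsAlgClosed.isGalois_of_finiteDimensional [FiniteDimensional L K] : IsGalois L K := by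
  have hsep : separableClosure L K = ⊤ := by
    rw [eq_top_iff]
    intro x _
    let E := separableClosure L K
    obtain ⟨p, hp⟩ := ExpChar.exists E
    have : ExpChar K p := expChar_of_injective_algebraMap (algebraMap E K).injective p
    -- One exponent serves all of `K`, and every `x` is a `p ^ n`-th power, so `x` lies in `E`.
    obtain ⟨n, hn⟩ : ∃ n, ∀ a : K, a ^ p ^ n ∈ (algebraMap E K).range :=
      ⟨_, IsPurelyInseparable.exponent_def' E p⟩
    obtain ⟨y, hy⟩ := IsAlgClosed.exists_pow_nat_eq x (n := p ^ n)
      (pow_pos (expChar_pos E p) n)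
    obtain ⟨e, he⟩ := hn y
    rw [← hy, ← he]
    exact e.2
  have : Algebra.IsSeparable L K := (separableClosure.eq_top_iff L K).1 hsep
  have : Normal L K := { splits' := fun x => IsAlgClosed.splits _ }
  constructor

/-- Cauchy's theorem gives an automorphism of order `p`, and `K` has degree `p` over its fixed
field. -/
lemma IsAlgClosed.eq_two_of_prime_dvd_finrank [FiniteDimensional L K] (p : ℕ)
    (hp : p.Prime) (hdvd : p ∣ Module.finrank L K) : p = 2 := by
  by_contra hodd
  have := Fact.mk hp
  have := IsAlgClosed.isGalois_of_finiteDimensional L K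
  rw [← IsGalois.card_aut_eq_finrank] at hdvd
  obtain ⟨s, hs⟩ := exists_prime_orderOf_dvd_card' p hdvd
  refine IsAlgClosed.finrank_ne_of_prime (fixedField (Subgroup.zpowers s)) K p hodd ?_
  rw [finrank_fixedField_eq_card, Nat.card_zpowers, hs]

/-- Over a field of finite codegree in an algebraically closed field, every polynomial of odd
degree has a root. -/
theorem Polynomial.exists_isRoot_of_odd_natDegree [FiniteDimensional L K] (f : L[X])
    (hf : Odd f.natDegree) : ∃ x, f.IsRoot x := by
  induction hn : f.natDegree using Nat.strong_induction_on generalizing f with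
  | _ n ih =>
  have hf0 : f ≠ 0 := by rintro rfl; simp at hf
  have hu : ¬ IsUnit f := fun h => by rw [natDegree_eq_zero_of_isUnit h] at hf; simp at hf
  obtain ⟨q, hq, r, rfl⟩ := WfDvdMonoid.exists_irreducible_factor hu hf0
  have hr0 : r ≠ 0 := right_ne_zero_of_mul hf0
  have hmul := natDegree_mul hq.ne_zero hr0
  by_cases hqo : Odd q.natDegree
  · have h1 : q.natDegree = 1 := by
      by_contra h1
      obtain ⟨p, hp, hpq⟩ := Nat.exists_prime_and_dvd h1
      obtain ⟨x, hx⟩ := IsAlgClosed.exists_aeval_eq_zero K q (degree_pos_of_irreducible hq).ne'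
      have hdvd : q.natDegree ∣ Module.finrank L K := by
        have := minpoly.degree_dvd (K := L) (Algebra.IsIntegral.isIntegral x)
        rwa [← minpoly.eq_of_irreducible hq hx, natDegree_mul_C
          (inv_ne_zero (leadingCoeff_ne_zero.2 hq.ne_zero))] at this
      have h2 := IsAlgClosed.eq_two_of_prime_dvd_finrank L K p hp (hpq.trans hdvd)
      subst h2
      exact (Nat.not_even_iff_odd.2 hqo) (even_iff_two_dvd.2 hpq)
    obtain ⟨x, hx⟩ := exists_root_of_degree_eq_one
      (by rw [degree_eq_natDegree hq.ne_zero, h1]; rfl : q.degree = 1)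
    exact ⟨x, root_mul_right_of_isRoot r hx⟩
  · have hro : Odd r.natDegree := by
      rw [hmul, Nat.odd_add] at hf
      rw [← Nat.not_even_iff_odd]
      exact fun h => hqo (hf.2 h)
    have hqpos := hq.natDegree_pos
    obtain ⟨x, hx⟩ := ih r.natDegree (by omega) r hro rfl
    exact ⟨x, root_mul_left_of_isRoot q hx⟩

end AlgClosed

/-! ### From preserved dependence to semilinearity -/

section Semilinear

variable {F V : Type*} [Field F] [AddCommGroup V] [Module F V]

open Submodule

/-- A fundamental theorem of projective geometry on the level of vectors: a map that preserves and
reflects linear dependence on pairs of vectors, and that is onto up to scalars, is semilinear up to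
scalars. -/
theorem exists_semilinear_of_mem_span_pair_iff {γ : V → V} (h0 : γ 0 = 0)
    (hγ : ∀ u v w, γ u ∈ span F {γ v, γ w} ↔ u ∈ span F {v, w})
    (hsurj : ∀ w, ∃ v, w ∈ span F {γ v})
    (φ : V →ₗ[F] F) (a : V) (ha : φ a = 1)
    (hdim : ∀ x, ∃ z, φ z = 0 ∧ z ∉ span F {x}) :
    ∃ (σ : F ≃+* F) (T : V →ₛₗ[(σ : F →+* F)] V), Function.Bijective T ∧
      ∀ v, ∃ c : F, c ≠ 0 ∧ γ v = c • T v := by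
  have hγ1 : ∀ u v, γ u ∈ span F {γ v} ↔ u ∈ span F {v} := by
    intro u v
    simpa using hγ u v v
  have hker : ∀ {u v w}, φ v = 0 → φ w = 0 → u ∈ span F {v, w} → φ u = 0 := by
    intro u v w hv hw hu
    obtain ⟨p, q, rfl⟩ := mem_span_pair.1 hu
    simp [hv, hw]
  have hker1 : ∀ {u v}, φ v = 0 → u ∈ span F {v} → φ u = 0 := by
    intro u v hv hu
    obtain ⟨p, rfl⟩ := mem_span_singleton.1 hu
    simp [hv]
  -- the action on the affine chart `φ = 1`
  have hτ : ∀ v, ∃ t, φ v = 0 → (∃ s : F, s ≠ 0 ∧ t = s • γ v) ∧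
      ∃ c : F, c ≠ 0 ∧ γ (a + v) = c • (γ a + t) := by
    intro v
    by_cases hv : φ v = 0
    swap
    · exact ⟨0, fun h => absurd h hv⟩
    by_cases hv0 : v = 0
    · exact ⟨0, fun _ => ⟨⟨1, one_ne_zero, by simp [hv0, h0]⟩, 1, one_ne_zero, by simp [hv0]⟩⟩
    obtain ⟨p, q, hpq⟩ := mem_span_pair.1
      ((hγ (a + v) a v).2 (mem_span_pair.2 ⟨1, 1, by simp⟩))
    have hp : p ≠ 0 := by
      rintro rfl
      have := hker1 hv ((hγ1 (a + v) v).1 (mem_span_singleton.2 ⟨q, by simpa using hpq⟩))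
      simp [ha, hv] at this
    have hq : q ≠ 0 := by
      rintro rfl
      have := (hγ1 (a + v) a).1 (mem_span_singleton.2 ⟨p, by simpa using hpq⟩)
      obtain ⟨k, hk⟩ := mem_span_singleton.1 this
      have hk1 := congrArg φ hk
      simp only [map_smul, map_add, ha, hv, smul_eq_mul, mul_one, add_zero] at hk1
      subst hk1
      exact hv0 (by simpa using hk)
    refine ⟨(p⁻¹ * q) • γ v, fun _ => ⟨⟨_, mul_ne_zero (inv_ne_zero hp) hq, rfl⟩, p, hp, ?_⟩⟩
    rw [← hpq, smul_add, smul_smul, mul_inv_cancel_left₀ hp]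
  -- For `v` in `ker φ`, `τ v` rescales `γ v` so that `γ a + τ v` is proportional to `γ (a + v)`.
  -- Values off `ker φ` are junk.
  choose τ hτ using hτ
  set b := γ a with hb
  have hτ0 : τ 0 = 0 := by
    obtain ⟨⟨s, -, h⟩, -⟩ := hτ 0 (map_zero φ)
    rw [h, h0, smul_zero]
  have hspan : ∀ v, φ v = 0 → span F {τ v} = span F {γ v} := by
    intro v hv
    obtain ⟨⟨s, hs, h⟩, -⟩ := hτ v hv
    rw [h]
    exact span_singleton_smul_eq hs.isUnit _
  have hspan' : ∀ v, φ v = 0 → span F {b + τ v} = span F {γ (a + v)} := by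
    intro v hv
    obtain ⟨-, s, hs, h⟩ := hτ v hv
    rw [h]
    exact (span_singleton_smul_eq hs.isUnit _).symm
  have hspan2 : ∀ v w, φ v = 0 → φ w = 0 → span F {τ v, τ w} = span F {γ v, γ w} := by
    intro v w hv hw
    rw [span_insert, span_insert, hspan v hv, hspan w hw]
  have hspan2' : ∀ v w, φ v = 0 → φ w = 0 → span F {b + τ v, τ w} = span F {γ (a + v), γ w} := by
    intro v w hv hw
    rw [span_insert, span_insert, hspan' v hv, hspan w hw]
  have hmem : ∀ {u v w}, φ u = 0 → φ v = 0 → φ w = 0 →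
      (τ u ∈ span F {τ v, τ w} ↔ u ∈ span F {v, w}) := by
    intro u v w hu hv hw
    rw [hspan2 v w hv hw, ← span_singleton_le_iff_mem, hspan u hu, span_singleton_le_iff_mem,
      hγ]
  have hmem1 : ∀ {u v}, φ u = 0 → φ v = 0 → (τ u ∈ span F {τ v} ↔ u ∈ span F {v}) := by
    intro u v hu hv
    simpa using hmem hu hv hv
  have hmem2 : ∀ {u v w}, φ u = 0 → φ v = 0 → φ w = 0 → a + u ∈ span F {a + v, w} →
      b + τ u ∈ span F {b + τ v, τ w} := by
    intro u v w hu hv hw h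
    rw [hspan2' v w hv hw, ← span_singleton_le_iff_mem, hspan' u hu, span_singleton_le_iff_mem]
    exact (hγ _ _ _).2 h
  have hbn : ∀ {v w}, φ v = 0 → φ w = 0 → b ∉ span F {τ v, τ w} := by
    intro v w hv hw h
    rw [hspan2 v w hv hw, hb, hγ] at h
    have := hker hv hw h
    rw [ha] at this
    exact one_ne_zero this
  have hbn1 : ∀ {v}, φ v = 0 → b ∉ span F {τ v} := by
    intro v hv
    simpa using hbn hv hv
  -- additivity for independent vectors
  have hpara : ∀ {x y}, φ x = 0 → φ y = 0 → ∃ q : F, τ (x + y) = τ x + q • τ y := by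
    intro x y hx hy
    have hxy : φ (x + y) = 0 := by simp [hx, hy]
    obtain ⟨p, q, hpq⟩ := mem_span_pair.1
      (hmem2 hxy hx hy (mem_span_pair.2 ⟨1, 1, by simp [add_assoc]⟩))
    obtain ⟨p', q', hpq'⟩ := mem_span_pair.1
      ((hmem hxy hx hy).2 (mem_span_pair.2 ⟨1, 1, by simp⟩))
    have hp : p = 1 := by
      by_contra hp
      have hp' : 1 - p ≠ 0 := sub_ne_zero.2 (Ne.symm hp)
      refine hbn hx hy (mem_span_pair.2
        ⟨(1 - p)⁻¹ * (p - p'), (1 - p)⁻¹ * (q - q'), ?_⟩)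
      rw [mul_smul, mul_smul, ← smul_add, inv_smul_eq_iff₀ hp']
      rw [← hpq'] at hpq
      linear_combination (norm := module) hpq
    subst hp
    refine ⟨q, ?_⟩
    rw [one_smul, add_assoc] at hpq
    exact (add_left_cancel hpq).symm
  have hadd_indep : ∀ {x y}, φ x = 0 → φ y = 0 → y ∉ span F {x} → τ (x + y) = τ x + τ y := by
    intro x y hx hy hxy
    obtain ⟨q, hq⟩ := hpara hx hy
    obtain ⟨q', hq'⟩ := hpara hy hx
    rw [add_comm y x, hq] at hq'
    have : q = 1 := by
      by_contra h
      have h' : q - 1 ≠ 0 := sub_ne_zero.2 h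
      refine hxy ((hmem1 hy hx).1 (mem_span_singleton.2 ⟨(q - 1)⁻¹ * (q' - 1), ?_⟩))
      rw [mul_smul, inv_smul_eq_iff₀ h']
      linear_combination (norm := module) -hq'
    rw [hq, this, one_smul]
  have hadd : ∀ {x y}, φ x = 0 → φ y = 0 → τ (x + y) = τ x + τ y := by
    intro x y hx hy
    by_cases hxy : y ∈ span F {x}
    swap
    · exact hadd_indep hx hy hxy
    obtain ⟨c, rfl⟩ := mem_span_singleton.1 hxy
    -- For dependent vectors, an auxiliary `z` off their span lets `x + c • x + z` be expanded in
    -- two ways.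
    obtain ⟨z, hz, hzx⟩ := hdim x
    have hzm : ∀ d : F, z ∉ span F {d • x} := fun d h =>
      hzx (span_singleton_le_iff_mem _ _ |>.2
        (smul_mem _ d (mem_span_singleton_self x)) h)
    have h1 : τ ((x + c • x) + z) = τ (x + c • x) + τ z := by
      refine hadd_indep (by simp [hx]) hz ?_
      rw [show x + c • x = (1 + c) • x by module]
      exact hzm _
    have h2 : τ (c • x + z) = τ (c • x) + τ z := hadd_indep hy hz (hzm c)
    have h3 : τ (x + (c • x + z)) = τ x + τ (c • x + z) := by
      refine hadd_indep hx (by simp [hx, hz]) fun h => hzx ?_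
      simpa using sub_mem h (smul_mem _ c (mem_span_singleton_self x))
    rw [add_assoc, h3, h2, ← add_assoc] at h1
    exact (add_right_cancel h1).symm
  -- the companion automorphism
  obtain ⟨x₀, hx₀, hx₀0⟩ := hdim 0
  have hne : ∀ {x}, φ x = 0 → x ≠ 0 → τ x ≠ 0 := by
    intro x hx hx' h
    have := (hmem1 hx (map_zero φ)).1 (by rw [h]; exact zero_mem _)
    simp at this
    exact hx' this
  have hx₀' : x₀ ≠ 0 := by
    rintro rfl
    exact hx₀0 (zero_mem _)
  have hscal : ∀ x (c : F), ∃ d : F, φ x = 0 → τ (c • x) = d • τ x := by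
    intro x c
    by_cases hx : φ x = 0
    · obtain ⟨d, hd⟩ := mem_span_singleton.1 ((hmem1 (u := c • x) (by simp [hx]) hx).2
        (smul_mem _ c (mem_span_singleton_self x)))
      exact ⟨d, fun _ => hd.symm⟩
    · exact ⟨0, fun h => absurd h hx⟩
  choose ρ hρ using hscal
  -- Expanding `τ (c • (x + y))` in two ways shows that the multiplier does not depend on the
  -- vector.
  have hρindep : ∀ {x y}, φ x = 0 → φ y = 0 → x ≠ 0 → y ∉ span F {x} → ∀ c, ρ x c = ρ y c := by
    intro x y hx hy hx0 hxy c
    have h1 := hρ (x + y) c (by simp [hx, hy])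
    rw [smul_add, hadd (by simp [hx]) (by simp [hy]), hadd hx hy, hρ x c hx, hρ y c hy] at h1
    have h2 : (ρ (x + y) c - ρ y c) • τ y = (ρ x c - ρ (x + y) c) • τ x := by
      linear_combination (norm := module) -h1
    have h3 : ρ (x + y) c = ρ y c := by
      by_contra h
      have h' := sub_ne_zero.2 h
      refine hxy ((hmem1 hy hx).1 (mem_span_singleton.2
        ⟨(ρ (x + y) c - ρ y c)⁻¹ * (ρ x c - ρ (x + y) c), ?_⟩))
      rw [mul_smul, inv_smul_eq_iff₀ h', h2]
    rw [h3, sub_self, zero_smul] at h2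
    exact sub_eq_zero.1 ((smul_eq_zero.1 h2.symm).resolve_right (hne hx hx0))
  have hsc : ∀ {x} (c : F), φ x = 0 → τ (c • x) = ρ x₀ c • τ x := by
    intro x c hx
    by_cases hx0 : x = 0
    · simp [hx0, hτ0]
    rw [hρ x c hx]
    congr 1
    by_cases hxx : x ∈ span F {x₀}
    · obtain ⟨z, hz, hzx⟩ := hdim x₀
      have hzx' : z ∉ span F {x} := fun h =>
        hzx ((span_singleton_le_iff_mem _ _).2 hxx h)
      rw [hρindep hx hz hx0 hzx', hρindep hx₀ hz hx₀' hzx]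
    · exact (hρindep hx₀ hx hx₀' hxx c).symm
  have hinj : ∀ {c d : F}, c • τ x₀ = d • τ x₀ → c = d := by
    intro c d h
    exact smul_left_injective F (hne hx₀ hx₀') h
  let σ₀ : F →+* F :=
    { toFun := ρ x₀
      map_one' := hinj (by rw [← hsc 1 hx₀, one_smul, one_smul])
      map_zero' := hinj (by rw [← hsc 0 hx₀, zero_smul, zero_smul, hτ0])
      map_mul' := fun c d => hinj (by
        rw [← hsc (c * d) hx₀, mul_smul, hsc c (by simp [hx₀]), hsc d hx₀, mul_smul])
      map_add' := fun c d => hinj (by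
        rw [← hsc (c + d) hx₀, add_smul, hadd (by simp [hx₀]) (by simp [hx₀]), hsc c hx₀,
          hsc d hx₀, add_smul]) }
  -- The preimage of the point `b + d • τ x₀` lies on the line through `a` and `x₀`. Normalised to
  -- `a + c • x₀`, it gives `σ₀ c = d`.
  have hσ₀ : Function.Surjective σ₀ := by
    intro d
    obtain ⟨v, hv⟩ := hsurj (b + d • τ x₀)
    obtain ⟨k, hk⟩ := mem_span_singleton.1 hv
    have hk0 : k ≠ 0 := by
      rintro rfl
      refine hbn1 hx₀ (mem_span_singleton.2 ⟨-d, ?_⟩)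
      rw [zero_smul] at hk
      linear_combination (norm := module) hk
    have hvs : v ∈ span F {a, x₀} := by
      rw [← hγ, span_insert, ← hspan x₀ hx₀, ← span_insert]
      refine mem_span_pair.2 ⟨k⁻¹, k⁻¹ * d, ?_⟩
      rw [mul_smul, ← smul_add, inv_smul_eq_iff₀ hk0, hk]
    obtain ⟨p, q, rfl⟩ := mem_span_pair.1 hvs
    have hp : p ≠ 0 := by
      rintro rfl
      have h1 : γ ((0 : F) • a + q • x₀) ∈ span F {τ x₀} := by
        rw [hspan x₀ hx₀, hγ1, zero_smul, zero_add]
        exact smul_mem _ q (mem_span_singleton_self x₀)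
      refine hbn1 hx₀ ?_
      have h2 := sub_mem (smul_mem _ k h1) (smul_mem _ d (mem_span_singleton_self (τ x₀)))
      rwa [hk, add_sub_cancel_right] at h2
    have h1 : b + d • τ x₀ ∈ span F {b + τ ((p⁻¹ * q) • x₀)} := by
      rw [hspan' _ (by simp [hx₀]), ← hk]
      refine smul_mem _ _ ((hγ1 _ _).2 (mem_span_singleton.2 ⟨p, ?_⟩))
      rw [smul_add, smul_smul, mul_inv_cancel_left₀ hp]
    obtain ⟨l, hl⟩ := mem_span_singleton.1 h1
    rw [hsc _ hx₀] at hl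
    have hl1 : l = 1 := by
      by_contra h
      have h' : 1 - l ≠ 0 := sub_ne_zero.2 (Ne.symm h)
      refine hbn1 hx₀ (mem_span_singleton.2
        ⟨(1 - l)⁻¹ * (l * ρ x₀ (p⁻¹ * q) - d), ?_⟩)
      rw [mul_smul, inv_smul_eq_iff₀ h', sub_smul, mul_smul]
      linear_combination (norm := module) hl
    rw [hl1, one_smul] at hl
    exact ⟨p⁻¹ * q, hinj (add_left_cancel hl)⟩
  let σ : F ≃+* F := RingEquiv.ofBijective σ₀ ⟨σ₀.injective, hσ₀⟩
  have hσ : ∀ c, σ c = ρ x₀ c := fun c => rfl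
  have hφ : ∀ w, φ (w - φ w • a) = 0 := fun w => by simp [ha]
  -- Extends `τ` along `V = F a ⊕ ker φ` by sending `a` to `b`.
  let T : V →ₛₗ[(σ : F →+* F)] V :=
    { toFun := fun w => σ (φ w) • b + τ (w - φ w • a)
      map_add' := fun v w => by
        rw [show v + w - φ (v + w) • a = (v - φ v • a) + (w - φ w • a) by rw [map_add]; module,
          hadd (hφ v) (hφ w), map_add, map_add]
        module
      map_smul' := fun c w => by
        rw [show c • w - φ (c • w) • a = c • (w - φ w • a) by
          rw [map_smul, smul_eq_mul]; module, hsc c (hφ w), map_smul, smul_eq_mul, map_mul,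
          smul_add, ← hσ, mul_smul]
        rfl }
  have hT : ∀ w, T w = σ (φ w) • b + τ (w - φ w • a) := fun w => rfl
  have hTγ : ∀ v, ∃ c : F, c ≠ 0 ∧ T v = c • γ v := by
    intro v
    by_cases hv : φ v = 0
    · obtain ⟨⟨s, hs, h⟩, -⟩ := hτ v hv
      exact ⟨s, hs, by rw [hT, hv, map_zero, zero_smul, zero_smul, sub_zero, zero_add, h]⟩
    · have hu : φ ((φ v)⁻¹ • (v - φ v • a)) = 0 := by rw [map_smul, hφ, smul_zero]
      obtain ⟨-, c, hc, h⟩ := hτ _ hu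
      have hav : a + (φ v)⁻¹ • (v - φ v • a) = (φ v)⁻¹ • v := by
        rw [smul_sub, inv_smul_smul₀ hv]; abel
      have hTv : T v = σ (φ v) • (b + τ ((φ v)⁻¹ • (v - φ v • a))) := by
        rw [hT, smul_add]
        congr 1
        rw [hσ, ← hsc _ hu, smul_inv_smul₀ hv]
      rw [hav] at h
      obtain ⟨k, hk⟩ := mem_span_singleton.1 ((hγ1 v ((φ v)⁻¹ • v)).2
        (mem_span_singleton.2 ⟨φ v, smul_inv_smul₀ hv v⟩))
      obtain ⟨k', hk'⟩ := mem_span_singleton.1 ((hγ1 ((φ v)⁻¹ • v) v).2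
        (smul_mem _ _ (mem_span_singleton_self v)))
      have hγ0 : γ v ≠ 0 := fun h' => by
        have := (hγ1 v 0).1 (by rw [h']; exact zero_mem _)
        simp at this
        exact hv (by rw [this, map_zero])
      have hk'0 : k' ≠ 0 := by
        rintro rfl
        rw [zero_smul] at hk'
        rw [← hk', smul_zero] at hk
        exact hγ0 hk.symm
      refine ⟨σ (φ v) * (c⁻¹ * k'), mul_ne_zero ((map_ne_zero σ).2 hv)
        (mul_ne_zero (inv_ne_zero hc) hk'0), ?_⟩
      rw [hTv, mul_smul, mul_smul, hk', h, inv_smul_smul₀ hc]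
  refine ⟨σ, T, ⟨?_, ?_⟩, ?_⟩
  · rw [injective_iff_map_eq_zero]
    intro v hv
    obtain ⟨c, hc, h⟩ := hTγ v
    rw [hv] at h
    have h' := (smul_eq_zero.1 h.symm).resolve_left hc
    have := (hγ1 v 0).1 (by rw [h']; exact zero_mem _)
    simpa using this
  · intro w
    obtain ⟨v, hv⟩ := hsurj w
    obtain ⟨k, rfl⟩ := mem_span_singleton.1 hv
    obtain ⟨c, hc, h⟩ := hTγ v
    refine ⟨σ.symm (k * c⁻¹) • v, ?_⟩
    rw [map_smulₛₗ, h]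
    simp [smul_smul, hc]
  · intro v
    obtain ⟨c, hc, h⟩ := hTγ v
    exact ⟨c⁻¹, inv_ne_zero hc, by rw [h, inv_smul_smul₀ hc]⟩

end Semilinear

/-! ### Collineations and their semilinear maps -/

section Collineations

variable {F V : Type*} [Field F] [AddCommGroup V] [Module F V]

open Submodule

lemma Projectivization.finrank_submodule_sup {p q : ℙ F V} (hpq : p ≠ q) :
    Module.finrank F (p.submodule ⊔ q.submodule : Submodule F V) = 2 := by
  have hli := Projectivization.linearIndependent_pair_iff_ne.2 hpq
  rw [Projectivization.submodule_eq, Projectivization.submodule_eq, ← span_insert]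
  have := finrank_span_eq_card hli
  have hr : Set.range ![p.rep, q.rep] = {p.rep, q.rep} := by simp [Set.pair_comm]
  rwa [hr, Fintype.card_fin] at this

/-- A collineation maps the line through two points into the line through their images. -/
lemma submodule_le_sup_of_mem_collineationGroup {g : Equiv.Perm (ℙ F V)}
    (hg : g ∈ collineationGroup F V) {p q r : ℙ F V} (h : r.submodule ≤ p.submodule ⊔ q.submodule) :
    (g r).submodule ≤ (g p).submodule ⊔ (g q).submodule := by
  by_cases hpq : p = q
  · subst hpq
    rw [sup_idem] at h ⊢
    have hle : r.submodule = p.submodule := by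
      have : FiniteDimensional F p.submodule :=
        .of_finrank_pos (by rw [p.finrank_submodule]; exact one_pos)
      exact eq_of_le_of_finrank_eq h (by rw [p.finrank_submodule, r.finrank_submodule])
    rw [Projectivization.submodule_injective hle]
  · obtain ⟨W, hW, hl⟩ := (hg _).2 ⟨p.submodule ⊔ q.submodule,
      Projectivization.finrank_submodule_sup hpq, rfl⟩
    have hmem : ∀ s : ℙ F V, s.submodule ≤ p.submodule ⊔ q.submodule → (g s).submodule ≤ W := by
      intro s hs
      have : g s ∈ g '' {s : ℙ F V | s.submodule ≤ p.submodule ⊔ q.submodule} := ⟨s, hs, rfl⟩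
      rwa [hl] at this
    have : FiniteDimensional F W := .of_finrank_pos (by rw [hW]; exact two_pos)
    -- The image line contains both image points, and dimension leaves only their join.
    have heq : (g p).submodule ⊔ (g q).submodule = W :=
      eq_of_le_of_finrank_eq (sup_le (hmem p le_sup_left) (hmem q le_sup_right))
        (by rw [hW, Projectivization.finrank_submodule_sup (g.injective.ne hpq)])
    rw [heq]
    exact hmem r h

/-- The fundamental theorem of projective geometry: collineations are induced by bijective
semilinear maps. -/
theorem exists_semilinear_of_mem_collineationGroup {g : Equiv.Perm (ℙ F V)}
    (hg : g ∈ collineationGroup F V) (φ : V →ₗ[F] F) (a : V) (ha : φ a = 1)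
    (hdim : ∀ x, ∃ z, φ z = 0 ∧ z ∉ span F {x}) :
    ∃ (σ : F ≃+* F) (T : V →ₛₗ[(σ : F →+* F)] V), Function.Bijective T ∧
      ∀ v (hv : v ≠ 0), (g (.mk F v hv)).submodule = span F {T v} := by
  classical
  -- Arbitrary representatives suffice, since semilinearity is only sought up to scalars.
  let γ : V → V := fun v => if hv : v = 0 then 0 else (g (.mk F v hv)).rep
  have h0 : γ 0 = 0 := by simp [γ]
  have hspan : ∀ v (hv : v ≠ 0), span F {γ v} = (g (.mk F v hv)).submodule := by
    intro v hv
    simp only [γ, dif_neg hv]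
    exact (Projectivization.submodule_eq _).symm
  have hγ0 : ∀ v, γ v = 0 → v = 0 := by
    intro v h
    by_contra hv
    simp only [γ, dif_neg hv] at h
    exact Projectivization.rep_nonzero _ h
  have hle1 : ∀ {u v : V} (hu : u ≠ 0) (hv : v ≠ 0),
      (γ u ∈ span F {γ v} ↔ u ∈ span F {v}) := by
    intro u v hu hv
    have key : ∀ p q : ℙ F V, p.submodule ≤ q.submodule ↔ p = q := by
      refine fun p q => ⟨fun h => Projectivization.submodule_injective ?_, fun h => h ▸ le_rfl⟩
      have : FiniteDimensional F q.submodule :=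
        .of_finrank_pos (by rw [q.finrank_submodule]; exact one_pos)
      exact eq_of_le_of_finrank_eq h (by rw [p.finrank_submodule, q.finrank_submodule])
    rw [← span_singleton_le_iff_mem, ← span_singleton_le_iff_mem, hspan u hu, hspan v hv, key,
      g.injective.eq_iff, ← key, Projectivization.submodule_mk, Projectivization.submodule_mk]
  have hγ : ∀ u v w, γ u ∈ span F {γ v, γ w} ↔ u ∈ span F {v, w} := by
    intro u v w
    by_cases hu : u = 0
    · simp [hu, h0]
    by_cases hv : v = 0
    · by_cases hw : w = 0
      · simp only [hv, hw, h0, Set.pair_eq_singleton, span_zero_singleton, mem_bot]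
        exact ⟨hγ0 u, fun h => absurd h hu⟩
      · rw [hv, h0, span_insert_zero, span_insert_zero]
        exact hle1 hu hw
    by_cases hw : w = 0
    · rw [hw, h0, Set.pair_comm, span_insert_zero, Set.pair_comm, span_insert_zero]
      exact hle1 hu hv
    have hinv := (collineationGroup F V).inv_mem hg
    rw [← span_singleton_le_iff_mem, ← span_singleton_le_iff_mem, span_insert, span_insert,
      hspan u hu, hspan v hv, hspan w hw, ← Projectivization.submodule_mk u hu,
      ← Projectivization.submodule_mk v hv, ← Projectivization.submodule_mk w hw]
    refine ⟨fun h => ?_, submodule_le_sup_of_mem_collineationGroup hg⟩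
    simpa using submodule_le_sup_of_mem_collineationGroup hinv h
  have hsurj : ∀ w, ∃ v, w ∈ span F {γ v} := by
    intro w
    by_cases hw : w = 0
    · exact ⟨0, by rw [hw]; exact zero_mem _⟩
    · refine ⟨(g.symm (.mk F w hw)).rep, ?_⟩
      rw [hspan _ (Projectivization.rep_nonzero _), Projectivization.mk_rep,
        Equiv.apply_symm_apply, Projectivization.submodule_mk]
      exact mem_span_singleton_self w
  obtain ⟨σ, T, hT, h⟩ := exists_semilinear_of_mem_span_pair_iff h0 hγ hsurj φ a ha hdim
  refine ⟨σ, T, hT, fun v hv => ?_⟩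
  obtain ⟨c, hc, hcv⟩ := h v
  rw [← hspan v hv, hcv]
  exact span_singleton_smul_eq hc.isUnit _

/-- Two bijective semilinear maps with the same companion automorphism agree on some point as soon
as every linear endomorphism has an eigenvector. -/
lemma exists_span_apply_eq_of_exists_eigenvector
    (heig : ∀ A : Module.End F V, ∃ (c : F) (v : V), v ≠ 0 ∧ A v = c • v)
    {σ : F ≃+* F} {T U : V →ₛₗ[(σ : F →+* F)] V} (hT : Function.Bijective T)
    (hU : Function.Bijective U) : ∃ v, v ≠ 0 ∧ span F {T v} = span F {U v} := by
  let e := Equiv.ofBijective U hU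
  have he : ∀ v, U (e.symm v) = v := fun v => e.apply_symm_apply v
  -- `A = U⁻¹ ∘ T` is linear because the companion automorphisms cancel.
  let A : Module.End F V :=
    { toFun := fun v => e.symm (T v)
      map_add' := fun v w => hU.1 (by rw [map_add U, he, he, he, map_add])
      map_smul' := fun c v => hU.1 (by
        rw [RingHom.id_apply, map_smulₛₗ U, he, he, map_smulₛₗ]) }
  obtain ⟨c, v, hv, h⟩ := heig A
  refine ⟨v, hv, ?_⟩
  have h1 : T v = σ c • U v := by
    have := congrArg U h
    rw [map_smulₛₗ] at this
    rw [← he (T v)]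
    exact this
  have hc : σ c ≠ 0 := by
    intro hc
    rw [hc, zero_smul, map_eq_zero_iff T hT.1] at h1
    exact hv h1
  rw [h1]
  exact span_singleton_smul_eq hc.isUnit _

end Collineations

/-! ### Eigenvectors in odd dimension and the counting argument -/

lemma Module.End.exists_eigenvector_of_odd_finrank {L V : Type*} (K : Type*) [Field L] [Field K]
    [Algebra L K] [IsAlgClosed K] [FiniteDimensional L K] [AddCommGroup V] [Module L V]
    [FiniteDimensional L V] (hodd : Odd (Module.finrank L V)) (A : Module.End L V) :
    ∃ (c : L) (v : V), v ≠ 0 ∧ A v = c • v := by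
  obtain ⟨c, hc⟩ := Polynomial.exists_isRoot_of_odd_natDegree L K A.charpoly
    (by rwa [LinearMap.charpoly_natDegree])
  obtain ⟨v, hv⟩ := ((Module.End.hasEigenvalue_iff_isRoot_charpoly A c).2 hc).exists_hasEigenvector
  exact ⟨c, v, hv.2, hv.apply_eq_smul⟩

theorem mainTheorem5 {F : Type*} [Field F] (m : ℕ) (hm : m ≠ 1)
    (hdeg : Module.rank F (AlgebraicClosure F) = (m : Cardinal))
    (haut : Cardinal.mk (F ≃+* F) < Cardinal.mk F)
    (n : ℕ) (hn : 3 ≤ n) (hodd : Odd n) :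
    ¬ ∃ S : Subgroup (Equiv.Perm (ℙ F (Fin n → F))), IsSingerGroup S := by
  rintro ⟨S, hS, hsharp⟩
  have hfin : FiniteDimensional F (AlgebraicClosure F) :=
    Module.rank_lt_aleph0_iff.1 (by rw [hdeg]; exact Cardinal.natCast_lt_aleph0)
  let i₀ : Fin n := ⟨0, by omega⟩
  let i₁ : Fin n := ⟨1, by omega⟩
  let i₂ : Fin n := ⟨2, by omega⟩
  have h01 : i₀ ≠ i₁ := by simp [i₀, i₁]
  have h02 : i₀ ≠ i₂ := by simp [i₀, i₂]
  have h12 : i₁ ≠ i₂ := by simp [i₁, i₂]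
  have heig : ∀ A : Module.End F (Fin n → F), ∃ (c : F) (v : (Fin n → F)), v ≠ 0 ∧ A v = c • v :=
    Module.End.exists_eigenvector_of_odd_finrank (AlgebraicClosure F) (by simpa using hodd)
  -- As `n ≥ 3`, the hyperplane contains two independent vectors, which cannot both lie in one line.
  have hdim : ∀ x : (Fin n → F), ∃ z : (Fin n → F), LinearMap.proj (R := F) (φ := fun _ => F) i₀ z = 0 ∧
      z ∉ Submodule.span F {x} := by
    intro x
    by_contra! h
    obtain ⟨c, hc⟩ := Submodule.mem_span_singleton.1 (h (Pi.single i₁ 1) (by simp [h01]))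
    obtain ⟨d, hd⟩ := Submodule.mem_span_singleton.1 (h (Pi.single i₂ 1) (by simp [h02]))
    have hc1 := congrFun hc i₁
    have hc2 := congrFun hc i₂
    have hd2 := congrFun hd i₂
    simp only [Pi.smul_apply, smul_eq_mul, Pi.single_eq_same,
      Pi.single_eq_of_ne h12.symm] at hc1 hc2 hd2
    rcases mul_eq_zero.1 hc2 with h | h
    · simp [h] at hc1
    · simp [h] at hd2
  have hsemi : ∀ g : S, ∃ (σ : F ≃+* F) (T : (Fin n → F) →ₛₗ[(σ : F →+* F)] (Fin n → F)), Function.Bijective T ∧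
      ∀ v (hv : v ≠ 0), (g.1 (.mk F v hv)).submodule = Submodule.span F {T v} := fun g =>
    exists_semilinear_of_mem_collineationGroup (hS g.2) (LinearMap.proj i₀) (Pi.single i₀ 1)
      (by simp) hdim
  choose σ T hT hgT using hsemi
  have hσ : Function.Injective σ := by
    intro g h hgh
    -- The companion occurs in the type of `U`; generalising it to `τ` allows the substitution.
    have key : ∀ (τ : F ≃+* F) (U : (Fin n → F) →ₛₗ[(τ : F →+* F)] (Fin n → F)), Function.Bijective U → σ g = τ →
        ∃ v, v ≠ 0 ∧ Submodule.span F {T g v} = Submodule.span F {U v} := by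
      rintro τ U hU rfl
      exact exists_span_apply_eq_of_exists_eigenvector heig (hT g) hU
    obtain ⟨v, hv, hspan⟩ := key (σ h) (T h) (hT h) hgh
    have heq : g.1 (.mk F v hv) = h.1 (.mk F v hv) :=
      Projectivization.submodule_injective (by rw [hgT, hgT, hspan])
    exact Subtype.ext ((hsharp (.mk F v hv) (h.1 (.mk F v hv))).unique ⟨g.2, heq⟩ ⟨h.2, rfl⟩)
  have hpt : ∀ c : F, (Pi.single i₀ 1 + Pi.single i₁ c : (Fin n → F)) ≠ 0 := fun c h => by
    simpa [h01] using congrFun h i₀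
  let pt : F → ℙ F (Fin n → F) := fun c => .mk F _ (hpt c)
  have hptinj : Function.Injective pt := by
    intro c d hcd
    obtain ⟨k, hk⟩ := (Projectivization.mk_eq_mk_iff' F _ _ (hpt c) (hpt d)).1 hcd
    have h0 := congrFun hk i₀
    have h1 := congrFun hk i₁
    simp [h01, h01.symm] at h0 h1
    rw [h0, one_mul] at h1
    exact h1.symm
  choose g hg using fun c => (hsharp (pt 0) (pt c)).exists
  have hginj : Function.Injective fun c => (⟨g c, (hg c).1⟩ : S) := by
    intro c d hcd
    apply hptinj
    have h : g c = g d := congrArg Subtype.val hcd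
    rw [← (hg c).2, ← (hg d).2, h]
  exact haut.not_ge (Cardinal.mk_le_of_injective (hσ.comp hginj))
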